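/- Let $m\ge 0$ be the number of bosonic modes, with Hilbert space $L^2(\mathbb R^m)$ and quadrature operators $R=(X_1,P_1,\dots,X_m,P_m)$, $[X_k,P_l]=i\,\delta_{kl}$. The Gaussian state with zero first moments and covariance matrix $V$ is the density operator $\rho$ with characteristic function $\chi_\rho(w):=\mathrm{Tr}[\rho\,e^{i w\cdot R}]=e^{-\frac12 w^{T}Vw}$ for all $w\in\mathbb R^{2m}$. An $m$-mode CV-GHZ state $\Phi_\mu$ is such a state whose covariance matrix has diagonal $2\times2$ blocks $\mu I$ and all off-diagonal blocks equal to $\Gamma=\mathrm{diag}(c_1,c_2)$, with $\mu,c_1,c_2\in\mathbb R$ (for $m\ge2$ and $\mu\ge\frac12$ this includes the choice $c_1=-c_2=\sqrt{\mu^2-1/4}/(m-1)$). Let $(\tau_B,\nu_B)$ and $(\tau_T,\nu_T)$ be the transmissivity and induced noise of a background and of a target Gaussian phase insensitive (GPI) channel, with $\tau_b\ge0$ and $\nu_b\ge|1-\tau_b|/2$. For a binary pattern $\boldsymbol i\in\{B,T\}^m$ let $\mathcal E_{\boldsymbol i}=\mathcal E_{i_1}\otimes\cdots\otimes\mathcal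 E_{i_m}$ be the GPI channel pattern, i.e. the Gaussian channel given on states by $\chi_{\mathcal E_{\boldsymbol i}(\rho)}(w)=\chi_\rho(X^{T}w)\,e^{-\frac12 w^{T}Yw}$ with $X=\bigoplus_k\sqrt{\tau_{i_k}}\,I$ and $Y=\bigoplus_k\nu_{i_k}I$ (so that $V\mapsto XVX^{T}+Y$), and put $\Phi_{\boldsymbol i,\mu}=\mathcal E_{\boldsymbol i}(\Phi_\mu)$. Let $F(\rho,\sigma)=\mathrm{Tr}\sqrt{\sqrt\rho\,\sigma\sqrt\rho}$ be the Bures fidelity. Theorem. For fixed $m,\mu,c_1,c_2,\tau_B,\tau_T,\nu_B,\nu_T$, the output fidelity $F(\Phi_{\boldsymbol i,\mu},\Phi_{\boldsymbol i',\mu})$ takes the same value for all pairs of patterns $(\boldsymbol i,\boldsymbol i')$ such that $\boldsymbol i$ has exactly $u$ target channels, $\boldsymbol i'$ has exactly $v$ target channels, and the Hamming distance between $\boldsymbol i$ and $\boldsymbol i'$ is $d$. That is, there is a function $(u,v,d)\mapsto F_{[u:v|d]}$ with $F(\Phi_{\boldsymbol i,\mu},\Phi_{\boldsymbol i',\mu})=F_{[u:v|d]}$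 for all such pairs. -/

import Mathlib

open MeasureTheory
open scoped InnerProductSpace

noncomputable section

/-- The Hilbert space of `m` bosonic modes, in the position representation `L²(ℝᵐ)`. -/
abbrev ModeSpace (m : ℕ) : Type := Lp ℂ 2 (volume : Measure (Fin m → ℝ))

/-- Quadrature labels: `(k, 0)` is the position and `(k, 1)` the momentum quadrature of mode `k`.
A vector indexed by them is a dual phase space vector, a matrix is a covariance matrix. -/
abbrev Quad (m : ℕ) : Type := Fin m × Fin 2

/-- The unimodular factor `exp (i (∑ₖ aₖ xₖ + ½ ∑ₖ aₖ bₖ))`, for `aₖ = w (k, 0)` and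
`bₖ = w (k, 1)`. -/
def weylPhase {m : ℕ} (w : Quad m → ℝ) (x : Fin m → ℝ) : ℂ :=
  Complex.exp (((∑ k, w (k, 0) * x k + (∑ k, w (k, 0) * w (k, 1)) / 2 : ℝ) : ℂ) * Complex.I)

theorem norm_weylPhase {m : ℕ} (w : Quad m → ℝ) (x : Fin m → ℝ) : ‖weylPhase w x‖ = 1 :=
  Complex.norm_exp_ofReal_mul_I _

theorem continuous_weylPhase {m : ℕ} (w : Quad m → ℝ) : Continuous (weylPhase w) := by
  unfold weylPhase
  fun_prop

theorem memLp_weylPhase_mul {m : ℕ} (w : Quad m → ℝ) (f : ModeSpace m) :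
    MemLp (fun x => weylPhase w x * f x) 2 (volume : Measure (Fin m → ℝ)) :=
  (Lp.memLp f).of_le
    ((continuous_weylPhase w).aestronglyMeasurable.mul (Lp.aestronglyMeasurable f))
    (Filter.Eventually.of_forall fun x => by simp [norm_weylPhase])

/-- Multiplication by the unimodular factor, as an isometry of `L²(ℝᵐ)`. -/
def weylMul {m : ℕ} (w : Quad m → ℝ) : ModeSpace m →ₗᵢ[ℂ] ModeSpace m where
  toFun f := (memLp_weylPhase_mul w f).toLp _
  map_add' f g := by
    rw [← MemLp.toLp_add]
    apply MemLp.toLp_congr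
    filter_upwards [Lp.coeFn_add f g] with x hx
    rw [hx]
    simp [mul_add]
  map_smul' c f := by
    rw [RingHom.id_apply, ← MemLp.toLp_const_smul]
    apply MemLp.toLp_congr
    filter_upwards [Lp.coeFn_smul c f] with x hx
    rw [hx]
    simp [mul_left_comm]
  norm_map' f := by
    change ‖(memLp_weylPhase_mul w f).toLp _‖ = ‖f‖
    rw [Lp.norm_toLp, Lp.norm_def]
    congr 1
    exact eLpNorm_congr_norm_ae (Filter.Eventually.of_forall fun x => by simp [norm_weylPhase])

/-- The Weyl (displacement) operator `exp (i ∑ₖ (aₖ Xₖ + bₖ Pₖ))` with `[Xₖ, Pₖ] = i`, that is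
`(W f)(x) = exp (i (a · x + a · b / 2)) f (x + b)`. -/
def weyl {m : ℕ} (w : Quad m → ℝ) : ModeSpace m →L[ℂ] ModeSpace m :=
  (weylMul w).toContinuousLinearMap ∘L
    (Lp.compMeasurePreservingₗᵢ ℂ (fun x : Fin m → ℝ => x + fun k => w (k, 1))
      (measurePreserving_add_right volume _)).toContinuousLinearMap

/-- The Weyl operator acts by the stated pointwise formula. -/
theorem weyl_apply_ae {m : ℕ} (w : Quad m → ℝ) (f : ModeSpace m) :
    ∀ᵐ x : Fin m → ℝ, (weyl w f : ModeSpace m) x =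
      weylPhase w x * f (x + fun k => w (k, 1)) := by
  have h := Lp.coeFn_compMeasurePreserving f
    (measurePreserving_add_right (volume : Measure (Fin m → ℝ)) (fun k => w (k, 1)))
  filter_upwards [(memLp_weylPhase_mul w (Lp.compMeasurePreserving _
    (measurePreserving_add_right (volume : Measure (Fin m → ℝ)) (fun k => w (k, 1))) f)).coeFn_toLp,
    h] with x h1 h2
  refine h1.trans ?_
  rw [h2]
  rfl

section Operators

variable {H : Type*} [NormedAddCommGroup H] [InnerProductSpace ℂ H] [CompleteSpace H]

/-- Index set of a fixed Hilbert basis of `H`. -/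
def basisIndex (H : Type*) [NormedAddCommGroup H] [InnerProductSpace ℂ H] [CompleteSpace H] :
    Set H :=
  (exists_hilbertBasis ℂ H).choose

/-- A fixed Hilbert basis of `H`. -/
def someBasis (H : Type*) [NormedAddCommGroup H] [InnerProductSpace ℂ H] [CompleteSpace H] :
    HilbertBasis (basisIndex H) ℂ H :=
  (exists_hilbertBasis ℂ H).choose_spec.choose

/-- The trace `∑ₙ ⟨eₙ, T eₙ⟩`; for trace class `T` it does not depend on the basis. -/
def opTrace (T : H →L[ℂ] H) : ℂ :=
  ∑' n, ⟪someBasis H n, T (someBasis H n)⟫_ℂ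

/-- A quantum state (density operator): a positive operator of trace one. -/
structure QState (H : Type*) [NormedAddCommGroup H] [InnerProductSpace ℂ H]
    [CompleteSpace H] where
  op : H →L[ℂ] H
  pos : op.IsPositive
  trace_one : HasSum (fun n => ⟪someBasis H n, op (someBasis H n)⟫_ℂ) 1

/-- The Bures fidelity `F(ρ, σ) = Tr √(√ρ σ √ρ)`. -/
def fidelity (ρ σ : QState H) : ℝ :=
  (opTrace (CFC.sqrt (CFC.sqrt ρ.op * σ.op * CFC.sqrt ρ.op))).re

end Operators

/-- A quantum state of `m` bosonic modes. -/
abbrev DensityOperator (m : ℕ) : Type := QState (ModeSpace m)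

/-- The quantum characteristic function `χ_ρ(w) = Tr (ρ exp (i w · R))`, `R` the vector of
quadrature operators. -/
def charFn {m : ℕ} (ρ : DensityOperator m) (w : Quad m → ℝ) : ℂ :=
  opTrace (ρ.op ∘L weyl w)

/-- `ρ` is the Gaussian state with zero first moments and covariance matrix `V`
(units in which the vacuum has covariance matrix `I / 2`). -/
def IsCenteredGaussian {m : ℕ} (V : Matrix (Quad m) (Quad m) ℝ) (ρ : DensityOperator m) : Prop :=
  ∀ w : Quad m → ℝ, charFn ρ w = Complex.exp ((-(w ⬝ᵥ V.mulVec w) / 2 : ℝ) : ℂ)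

/-- The CV-GHZ covariance matrix: diagonal blocks `μ I`, off-diagonal blocks `diag(c₁, c₂)`. -/
def ghzCov (m : ℕ) (μ c₁ c₂ : ℝ) : Matrix (Quad m) (Quad m) ℝ :=
  Matrix.of fun p q =>
    if p.2 = q.2 then (if p.1 = q.1 then μ else ![c₁, c₂] p.2) else 0

/-- `Φ` is the `m`-mode CV-GHZ state with parameters `μ`, `c₁`, `c₂`. -/
def IsCVGHZ {m : ℕ} (μ c₁ c₂ : ℝ) (Φ : DensityOperator m) : Prop :=
  IsCenteredGaussian (ghzCov m μ c₁ c₂) Φ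

/-- A binary channel pattern of length `m`: `true` is a target, `false` a background channel. -/
abbrev Pattern (m : ℕ) : Type := Fin m → Bool

/-- The patterns of length `m` with exactly `u` target channels. -/
def cpfSpace (m u : ℕ) : Set (Pattern m) :=
  {i | (Finset.univ.filter fun k => i k = true).card = u}

/-- The block diagonal matrix with the `2 × 2` blocks `a_{i_k} I`, `k = 1, …, m`. -/
def patternMatrix {m : ℕ} (a : Bool → ℝ) (i : Pattern m) : Matrix (Quad m) (Quad m) ℝ :=
  Matrix.diagonal fun p => a (i p.1)

/-- `E` is the multi-channel `E_{i_1} ⊗ … ⊗ E_{i_m}`, in which `E_b` is the Gaussian phase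
insensitive channel of transmissivity `τ b` and induced noise `ν b`. In terms of characteristic
functions, it is the Gaussian channel `χ(w) ↦ χ(Xᵀ w) exp (-½ w · Y w)`, with `X = ⨁ √τ_{i_k} I`
and `Y = ⨁ ν_{i_k} I`, so that it maps covariance matrices by `V ↦ X V Xᵀ + Y`.
The bound on the noise is complete positivity. -/
structure IsGPIPattern {m : ℕ} (τ ν : Bool → ℝ) (i : Pattern m)
    (E : DensityOperator m → DensityOperator m) : Prop where
  transmissivity_nonneg : ∀ b, 0 ≤ τ b
  noise_bound : ∀ b, |1 - τ b| / 2 ≤ ν b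
  charFn_apply : ∀ (ρ : DensityOperator m) (w : Quad m → ℝ),
    charFn (E ρ) w =
      charFn ρ ((patternMatrix (fun b => Real.sqrt (τ b)) i).transpose.mulVec w) *
        Complex.exp ((-(w ⬝ᵥ (patternMatrix ν i).mulVec w) / 2 : ℝ) : ℂ)

end

/-!
The two patterns enter the fidelity only through the states `E_i(Φ)` and `E_{i'}(Φ)`, and the
CV-GHZ covariance matrix does not change when the modes are permuted. If `(i, i')` and `(j, j')`
have the same numbers `u`, `v` of targets and the same Hamming distance, then the four kinds of
positions (target/target, target/background, …) occur equally often in both pairs, so one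
permutation `π` of the modes carries `i` to `j` and `i'` to `j'` simultaneously
(`exists_perm_of_hammingDist_eq`). The characteristic functions of the outputs are then related by
the relabelling `π` of the quadratures. Permuting the coordinates of `L²(ℝᵐ)` is a unitary `U_π`
that implements this relabelling on Weyl operators (`weyl_permUnitary`), so both outputs are
conjugated by the same `U_π` (`output_op_eq_unitaryConj`), and the fidelity is unitarily invariant
(`fidelity_eq_of_unitaryConj`).

The analytic content is that a state is determined by its characteristic function
(`IsEnsemble.eq_of_tsum_inner_weyl_eq`). A state is written as `ρ = ∑ₖ |fₖ⟩⟨fₖ|` with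
`∑ₖ ‖fₖ‖² < ∞`, where `fₖ = √ρ eₖ`; no spectral theorem for compact operators is needed. A double
series argument gives `Tr (ρ A) = ∑ₖ ⟨fₖ, A fₖ⟩` for bounded `A` (`IsEnsemble.opTrace_comp`). For
the Weyl operator of `w = (a, b)` this is, up to a phase, the Fourier transform at `a` of the `L¹`
function `x ↦ ∑ₖ conj (fₖ x) fₖ (x + b)`, the off-diagonal at distance `b` of the integral kernel
of `ρ`. Fourier injectivity on `L¹(ℝᵐ)` recovers every off-diagonal, and Fubini's theorem
assembles the matrix elements `⟨g, ρ h⟩` from them.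
-/

open MeasureTheory
open scoped InnerProductSpace

/-! ### Ensembles, traces and unitary invariance of the fidelity -/

section Ensembles

variable {H : Type*} [NormedAddCommGroup H] [InnerProductSpace ℂ H]

/-- The family `f` of (unnormalised, not necessarily orthogonal) vectors is an ensemble for `T`:
`∑ₖ ‖fₖ‖² < ∞` and `T = ∑ₖ |fₖ⟩⟨fₖ|`, the latter in the weak sense. -/
structure IsEnsemble {κ : Type*} (T : H →L[ℂ] H) (f : κ → H) : Prop where
  summable_sq : Summable fun k => ‖f k‖ ^ 2
  hasSum_inner : ∀ g h : H, HasSum (fun k => ⟪g, f k⟫_ℂ * ⟪f k, h⟫_ℂ) ⟪g, T h⟫_ℂ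

/-- The conjugate `U T U*` of an operator by a unitary. -/
def unitaryConj (U : H ≃ₗᵢ[ℂ] H) (T : H →L[ℂ] H) : H →L[ℂ] H :=
  (U : H →L[ℂ] H) ∘L T ∘L (U.symm : H →L[ℂ] H)

theorem unitaryConj_apply (U : H ≃ₗᵢ[ℂ] H) (T : H →L[ℂ] H) (x : H) :
    unitaryConj U T x = U (T (U.symm x)) := rfl

theorem unitaryConj_mul (U : H ≃ₗᵢ[ℂ] H) (S T : H →L[ℂ] H) :
    unitaryConj U (S * T) = unitaryConj U S * unitaryConj U T := by
  ext x
  simp [unitaryConj_apply]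

/-- A unitary transports ensembles: `U T U*` has the ensemble `U fₖ`. -/
theorem IsEnsemble.map {κ : Type*} {T : H →L[ℂ] H} {f : κ → H} (hf : IsEnsemble T f)
    (U : H ≃ₗᵢ[ℂ] H) : IsEnsemble (unitaryConj U T) fun k => U (f k) where
  summable_sq := by simpa using hf.summable_sq
  hasSum_inner g h := by
    have h1 := hf.hasSum_inner (U.symm g) (U.symm h)
    rw [← U.inner_map_map] at h1
    simp_rw [← U.inner_map_map (U.symm g), ← U.inner_map_map _ (U.symm h),
      U.apply_symm_apply] at h1
    exact h1

theorem HilbertBasis.hasSum_norm_inner_sq {ι : Type*} (e : HilbertBasis ι ℂ H) (x : H) :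
    HasSum (fun n => ‖⟪x, e n⟫_ℂ‖ ^ 2) (‖x‖ ^ 2) := by
  have h := e.hasSum_inner_mul_inner x x
  rw [inner_self_eq_norm_sq_to_K] at h
  simp_rw [← inner_conj_symm (e _) x, RCLike.mul_conj] at h
  exact_mod_cast h

theorem HilbertBasis.summable_prod_norm_inner_sq {ι κ : Type*} (e : HilbertBasis ι ℂ H)
    {f : κ → H} (hf : Summable fun k => ‖f k‖ ^ 2) :
    Summable fun p : κ × ι => ‖⟪f p.1, e p.2⟫_ℂ‖ ^ 2 := by
  refine (summable_prod_of_nonneg fun _ => by positivity).2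
    ⟨fun k => (e.hasSum_norm_inner_sq (f k)).summable, ?_⟩
  simpa only [(e.hasSum_norm_inner_sq _).tsum_eq] using hf

theorem HilbertBasis.tsum_ofReal_norm_inner_sq {ι : Type*} (e : HilbertBasis ι ℂ H) (x : H) :
    ∑' n, ENNReal.ofReal (‖⟪x, e n⟫_ℂ‖ ^ 2) = ENNReal.ofReal (‖x‖ ^ 2) := by
  have h := e.hasSum_norm_inner_sq x
  rw [← h.tsum_eq, ENNReal.ofReal_tsum_of_nonneg (fun _ => by positivity) h.summable]

variable [CompleteSpace H]

theorem inner_sqrt_left (T : H →L[ℂ] H) (g h : H) :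
    ⟪CFC.sqrt T g, h⟫_ℂ = ⟪g, CFC.sqrt T h⟫_ℂ := by
  have h0 : (CFC.sqrt T).IsPositive :=
    (ContinuousLinearMap.nonneg_iff_isPositive _).1 (CFC.sqrt_nonneg T)
  exact h0.isSelfAdjoint.isSymmetric g h

theorem inner_apply_eq_inner_sqrt {T : H →L[ℂ] H} (hT : 0 ≤ T) (g h : H) :
    ⟪g, T h⟫_ℂ = ⟪CFC.sqrt T g, CFC.sqrt T h⟫_ℂ := by
  conv_lhs => rw [← CFC.sqrt_mul_sqrt_self T hT]
  exact (inner_sqrt_left T g _).symm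

theorem inner_apply_self_eq_norm_sqrt_sq {T : H →L[ℂ] H} (hT : 0 ≤ T) (g : H) :
    ⟪g, T g⟫_ℂ = ((‖CFC.sqrt T g‖ ^ 2 : ℝ) : ℂ) := by
  rw [inner_apply_eq_inner_sqrt hT, inner_self_eq_norm_sq_to_K]
  simp

/-- The columns `√ρ eₙ` of the square root of a state form an ensemble for it; the zero columns
are dropped to make the index set countable. -/
theorem QState.exists_isEnsemble (ρ : QState H) :
    ∃ (s : Set (basisIndex H)) (f : s → H), Countable s ∧ IsEnsemble ρ.op f := by
  have hT : 0 ≤ ρ.op := (ContinuousLinearMap.nonneg_iff_isPositive _).2 ρ.pos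
  set e := someBasis H
  have hs : Summable fun n => ‖CFC.sqrt ρ.op (e n)‖ ^ 2 := by
    have h := ρ.trace_one.summable
    simp_rw [inner_apply_self_eq_norm_sqrt_sq hT] at h
    exact Complex.summable_ofReal.1 h
  refine ⟨Function.support fun n => ‖CFC.sqrt ρ.op (e n)‖ ^ 2, fun n => CFC.sqrt ρ.op (e n),
    hs.countable_support, hs.subtype _, fun g h => ?_⟩
  have h1 := e.hasSum_inner_mul_inner (CFC.sqrt ρ.op g) (CFC.sqrt ρ.op h)
  rw [← inner_apply_eq_inner_sqrt hT] at h1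
  simp_rw [inner_sqrt_left, ← inner_sqrt_left ρ.op (e _)] at h1
  refine (hasSum_subtype_iff_of_support_subset fun n hn => ?_).2 h1
  contrapose! hn
  simp_all

/-- Expanding `⟨eₙ, T A eₙ⟩` in the ensemble and summing over the basis `eₙ` first removes the
dependence on the basis. -/
theorem IsEnsemble.opTrace_comp {κ : Type*} {T : H →L[ℂ] H} {f : κ → H} (hf : IsEnsemble T f)
    (A : H →L[ℂ] H) : opTrace (T ∘L A) = ∑' k, ⟪f k, A (f k)⟫_ℂ := by
  set e := someBasis H
  have hA : Summable fun k => ‖A.adjoint (f k)‖ ^ 2 := by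
    refine Summable.of_nonneg_of_le (fun _ => by positivity) (fun k => ?_)
      (hf.summable_sq.mul_left (‖A.adjoint‖ ^ 2))
    rw [← mul_pow]
    gcongr
    exact A.adjoint.le_opNorm _
  -- The double series converges absolutely: `2 |x y| ≤ |x|² + |y|²`, and both families of inner
  -- products are square summable by Parseval.
  have hsum : Summable fun p : κ × basisIndex H =>
      ⟪e p.2, f p.1⟫_ℂ * ⟪f p.1, A (e p.2)⟫_ℂ := by
    refine Summable.of_norm_bounded ((e.summable_prod_norm_inner_sq hf.summable_sq).add
      (e.summable_prod_norm_inner_sq hA)) fun p => ?_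
    rw [norm_mul, norm_inner_symm, ← ContinuousLinearMap.adjoint_inner_left]
    nlinarith [sq_nonneg (‖⟪f p.1, e p.2⟫_ℂ‖ - ‖⟪A.adjoint (f p.1), e p.2⟫_ℂ‖),
      sq_nonneg (‖⟪f p.1, e p.2⟫_ℂ‖), sq_nonneg (‖⟪A.adjoint (f p.1), e p.2⟫_ℂ‖)]
  calc opTrace (T ∘L A)
      = ∑' n, ∑' k, ⟪e n, f k⟫_ℂ * ⟪f k, A (e n)⟫_ℂ :=
        tsum_congr fun n => ((hf.hasSum_inner (e n) (A (e n))).tsum_eq).symm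
    _ = ∑' k, ∑' n, ⟪e n, f k⟫_ℂ * ⟪f k, A (e n)⟫_ℂ :=
        (Summable.tsum_comm (f := fun k n => ⟪e n, f k⟫_ℂ * ⟪f k, A (e n)⟫_ℂ) hsum)
    _ = ∑' k, ⟪f k, A (f k)⟫_ℂ := by
        refine tsum_congr fun k => ?_
        rw [← ContinuousLinearMap.adjoint_inner_left, ← e.tsum_inner_mul_inner]
        refine tsum_congr fun n => ?_
        rw [ContinuousLinearMap.adjoint_inner_left, mul_comm]

theorem unitaryConj_nonneg (U : H ≃ₗᵢ[ℂ] H) {T : H →L[ℂ] H} (hT : 0 ≤ T) :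
    0 ≤ unitaryConj U T := by
  rw [ContinuousLinearMap.nonneg_iff_isPositive] at hT ⊢
  have h := hT.conj_adjoint (U : H →L[ℂ] H)
  rwa [U.adjoint_eq_symm] at h

theorem sqrt_unitaryConj (U : H ≃ₗᵢ[ℂ] H) {T : H →L[ℂ] H} (hT : 0 ≤ T) :
    CFC.sqrt (unitaryConj U T) = unitaryConj U (CFC.sqrt T) :=
  CFC.sqrt_unique (by rw [← unitaryConj_mul, CFC.sqrt_mul_sqrt_self T hT])
    (unitaryConj_nonneg U (CFC.sqrt_nonneg T))

/-- Both sides are the squared Hilbert–Schmidt norm of `√T`, possibly infinite. -/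
theorem tsum_ofReal_norm_sqrt_sq_eq {ι κ : Type*} (T : H →L[ℂ] H) (e : HilbertBasis ι ℂ H)
    (e' : HilbertBasis κ ℂ H) :
    ∑' n, ENNReal.ofReal (‖CFC.sqrt T (e n)‖ ^ 2) =
      ∑' k, ENNReal.ofReal (‖CFC.sqrt T (e' k)‖ ^ 2) := by
  simp_rw [← e'.tsum_ofReal_norm_inner_sq (CFC.sqrt T (e _)),
    ← e.tsum_ofReal_norm_inner_sq (CFC.sqrt T (e' _))]
  rw [ENNReal.tsum_comm]
  refine tsum_congr fun k => tsum_congr fun n => ?_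
  rw [inner_sqrt_left, norm_inner_symm]

theorem tsum_inner_apply_eq_toReal {ι : Type*} {T : H →L[ℂ] H} (hT : 0 ≤ T) (e : ι → H) :
    ∑' n, ⟪e n, T (e n)⟫_ℂ =
      (((∑' n, ENNReal.ofReal (‖CFC.sqrt T (e n)‖ ^ 2)).toReal : ℝ) : ℂ) := by
  simp_rw [inner_apply_self_eq_norm_sqrt_sq hT]
  rw [ENNReal.tsum_toReal_eq fun _ => ENNReal.ofReal_ne_top, ← Complex.ofReal_tsum]
  congr 1
  exact tsum_congr fun n => (ENNReal.toReal_ofReal (by positivity)).symm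

/-- The trace of a positive operator can be computed in any Hilbert basis. There is no hypothesis
that `T` is trace class: if it is not, both series diverge and both sums are zero by convention. -/
theorem opTrace_eq_tsum_of_nonneg {κ : Type*} {T : H →L[ℂ] H} (hT : 0 ≤ T)
    (e : HilbertBasis κ ℂ H) : opTrace T = ∑' k, ⟪e k, T (e k)⟫_ℂ := by
  rw [opTrace, tsum_inner_apply_eq_toReal hT, tsum_inner_apply_eq_toReal hT,
    tsum_ofReal_norm_sqrt_sq_eq T (someBasis H) e]

theorem opTrace_unitaryConj (U : H ≃ₗᵢ[ℂ] H) {T : H →L[ℂ] H} (hT : 0 ≤ T) :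
    opTrace (unitaryConj U T) = opTrace T := by
  have hb : ∀ n, HilbertBasis.ofRepr (U.symm.trans (someBasis H).repr) n = U (someBasis H n) :=
    fun n => by classical
      rw [← HilbertBasis.repr_symm_single, ← HilbertBasis.repr_symm_single]; rfl
  rw [opTrace_eq_tsum_of_nonneg (unitaryConj_nonneg U hT)
    (HilbertBasis.ofRepr (U.symm.trans (someBasis H).repr)), opTrace]
  simp [hb, unitaryConj_apply]

theorem fidelity_eq_of_unitaryConj (U : H ≃ₗᵢ[ℂ] H) {ρ σ ρ' σ' : QState H}
    (hρ : ρ'.op = unitaryConj U ρ.op) (hσ : σ'.op = unitaryConj U σ.op) :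
    fidelity ρ' σ' = fidelity ρ σ := by
  have hρ0 : 0 ≤ ρ.op := (ContinuousLinearMap.nonneg_iff_isPositive _).2 ρ.pos
  have hσ0 : 0 ≤ σ.op := (ContinuousLinearMap.nonneg_iff_isPositive _).2 σ.pos
  have h : 0 ≤ CFC.sqrt ρ.op * σ.op * CFC.sqrt ρ.op :=
    conjugate_nonneg_of_nonneg hσ0 (CFC.sqrt_nonneg ρ.op)
  rw [fidelity, fidelity, hρ, hσ, sqrt_unitaryConj U hρ0, ← unitaryConj_mul, ← unitaryConj_mul,
    sqrt_unitaryConj U h, opTrace_unitaryConj U (CFC.sqrt_nonneg _)]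

end Ensembles

/-! ### Injectivity of the Fourier transform on `L¹` -/

section Fourier

/-- A series of integrable functions that converges absolutely in `L¹` has an integrable sum, and
it may be integrated term by term against any bounded function. -/
theorem exists_integrable_hasSum_integral_mul {κ α : Type*} [Countable κ] [MeasurableSpace α]
    {ν : Measure α} {F : κ → α → ℂ} (hF : ∀ k, Integrable (F k) ν)
    (hs : Summable fun k => ∫ x, ‖F k x‖ ∂ν) :
    ∃ G : α → ℂ, Integrable G ν ∧ ∀ φ : α → ℂ, AEStronglyMeasurable φ ν →
      (∃ C, ∀ᵐ x ∂ν, ‖φ x‖ ≤ C) → HasSum (fun k => ∫ x, φ x * F k x ∂ν) (∫ x, φ x * G x ∂ν) := by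
  have hlt : ∑' k, ∫⁻ x, ‖F k x‖ₑ ∂ν ≠ ⊤ := by
    simp_rw [← ofReal_integral_norm_eq_lintegral_enorm (hF _)]
    rw [← ENNReal.ofReal_tsum_of_nonneg (fun k => integral_nonneg fun x => norm_nonneg _) hs]
    exact ENNReal.ofReal_ne_top
  rw [← lintegral_tsum fun k => (hF k).aestronglyMeasurable.enorm] at hlt
  have hsum : ∀ᵐ x ∂ν, Summable fun k => F k x := by
    filter_upwards [ae_lt_top' (AEMeasurable.tsum fun k => (hF k).aestronglyMeasurable.enorm)
      hlt] with x hx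
    refine Summable.of_norm ?_
    have := ENNReal.summable_toReal hx.ne
    simpa using this
  refine ⟨fun x => ∑' k, F k x, ⟨?_, ?_⟩, fun φ hφ ⟨C, hC⟩ => ?_⟩
  · refine aestronglyMeasurable_of_tendsto_ae (Filter.atTop : Filter (Finset κ))
      (f := fun s x => ∑ k ∈ s, F k x)
      (fun s => Finset.aestronglyMeasurable_fun_sum s fun k _ => (hF k).aestronglyMeasurable) ?_
    filter_upwards [hsum] with x hx using hx.hasSum
  · refine lt_of_le_of_lt (lintegral_mono fun x => ?_) (lt_top_iff_ne_top.2 hlt)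
    exact enorm_tsum_le_tsum_enorm
  · have hi : ∀ k, Integrable (fun x => φ x * F k x) ν := fun k => (hF k).bdd_mul hφ hC
    have h := hasSum_integral_of_summable_integral_norm hi ?_
    · simpa only [tsum_mul_left] using h
    · refine Summable.of_nonneg_of_le (fun k => integral_nonneg fun x => norm_nonneg _)
        (fun k => ?_) (hs.mul_left C)
      rw [← integral_const_mul]
      refine integral_mono_ae (hi k).norm ((hF k).norm.const_mul C) ?_
      filter_upwards [hC] with x hx
      rw [norm_mul]
      gcongr

/-- The positive and the negative part of `g` are densities of finite measures with equal
characteristic functions, so they coincide; having disjoint supports, they vanish. -/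
theorem ae_eq_zero_of_real_integral_exp_eq_zero {m : ℕ} {g : (Fin m → ℝ) → ℝ} (hg : Integrable g)
    (h : ∀ a : Fin m → ℝ,
      ∫ x, Complex.exp (((∑ k, a k * x k : ℝ) : ℂ) * Complex.I) * g x = 0) :
    g =ᵐ[volume] 0 := by
  set e : (Fin m → ℝ) → (Fin m → ℝ) → ℂ := fun a x =>
    Complex.exp (((∑ k, a k * x k : ℝ) : ℂ) * Complex.I) with he
  have hb : ∀ a : Fin m → ℝ, ∀ f : (Fin m → ℝ) → ℝ, Integrable f →
      Integrable fun x => f x • e a x := fun a f hf =>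
    hf.smul_bdd 1 (Continuous.aestronglyMeasurable (by fun_prop))
      (Filter.Eventually.of_forall fun x => (Complex.norm_exp_ofReal_mul_I _).le)
  have hpos : Integrable fun x => (ENNReal.ofReal (g x)).toReal := by
    simpa only [ENNReal.toReal_ofReal'] using hg.pos_part
  have hneg : Integrable fun x => (ENNReal.ofReal (-g x)).toReal := by
    simpa only [ENNReal.toReal_ofReal'] using hg.neg_part
  have hn : Integrable fun x => -g x := hg.neg
  have := isFiniteMeasure_withDensity_ofReal hg.2
  have := isFiniteMeasure_withDensity_ofReal hn.2
  have hm : volume.withDensity (fun x => ENNReal.ofReal (g x)) =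
      volume.withDensity (fun x => ENNReal.ofReal (-g x)) := by
    refine Measure.ext_of_charFunDual (funext fun L => ?_)
    have hL : ∀ x, L x = ∑ k, L (Pi.single k 1) * x k := fun x => by
      conv_lhs => rw [pi_eq_sum_univ' x, map_sum]
      exact Finset.sum_congr rfl fun k _ => by
        rw [map_smul, smul_eq_mul, mul_comm]
    have hLe : ∀ x, Complex.exp (L x * Complex.I) = e (fun k => L (Pi.single k 1)) x := fun x => by
      rw [he, hL x]
    rw [charFunDual_apply, charFunDual_apply,
      integral_withDensity_eq_integral_toReal_smul₀ hg.aemeasurable.ennreal_ofReal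
        (Filter.Eventually.of_forall fun x => ENNReal.ofReal_lt_top),
      integral_withDensity_eq_integral_toReal_smul₀ hn.aemeasurable.ennreal_ofReal
        (Filter.Eventually.of_forall fun x => ENNReal.ofReal_lt_top), ← sub_eq_zero]
    simp_rw [hLe]
    rw [← integral_sub (hb _ _ hpos) (hb _ _ hneg), ← h fun k => L (Pi.single k 1)]
    refine integral_congr_ae (Filter.Eventually.of_forall fun x => ?_)
    simp only [ENNReal.toReal_ofReal', ← sub_smul]
    rw [max_zero_sub_max_neg_zero_eq_self, Complex.real_smul, mul_comm]
  have h2 := (withDensity_eq_iff hg.aemeasurable.ennreal_ofReal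
    hn.aemeasurable.ennreal_ofReal ?_).1 hm
  · filter_upwards [h2] with x hx
    rcases le_total 0 (g x) with h0 | h0
    · have : ENNReal.ofReal (-g x) = 0 := ENNReal.ofReal_of_nonpos (by simpa)
      rw [this, ENNReal.ofReal_eq_zero] at hx
      exact le_antisymm hx h0
    · rw [ENNReal.ofReal_of_nonpos h0, eq_comm, ENNReal.ofReal_eq_zero] at hx
      exact le_antisymm h0 (by simpa using hx)
  · exact hg.lintegral_lt_top.ne

/-- Injectivity of the Fourier transform on `L¹(ℝᵐ)`. -/
theorem ae_eq_zero_of_integral_exp_eq_zero {m : ℕ} {G : (Fin m → ℝ) → ℂ} (hG : Integrable G)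
    (h : ∀ a : Fin m → ℝ,
      ∫ x, Complex.exp (((∑ k, a k * x k : ℝ) : ℂ) * Complex.I) * G x = 0) :
    G =ᵐ[volume] 0 := by
  have hb : ∀ a : Fin m → ℝ, ∀ f : (Fin m → ℝ) → ℂ, Integrable f →
      Integrable fun x => Complex.exp (((∑ k, a k * x k : ℝ) : ℂ) * Complex.I) * f x :=
    fun a f hf => hf.bdd_mul (c := 1) (Continuous.aestronglyMeasurable (by fun_prop))
      (Filter.Eventually.of_forall fun x => (Complex.norm_exp_ofReal_mul_I _).le)
  have hconj : ∀ a : Fin m → ℝ,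
      ∫ x, Complex.exp (((∑ k, a k * x k : ℝ) : ℂ) * Complex.I) * starRingEnd ℂ (G x) = 0 := by
    intro a
    have h1 := congrArg (starRingEnd ℂ) (h (-a))
    rw [← integral_conj, map_zero] at h1
    rw [← h1]
    congr 1
    ext x
    rw [map_mul, ← Complex.exp_conj, map_mul, Complex.conj_I, Complex.conj_ofReal]
    simp
  have hGc : Integrable fun x => starRingEnd ℂ (G x) :=
    hG.congr' (RCLike.continuous_conj.comp_aestronglyMeasurable hG.1) (by simp)
  -- `G ± conj G` have vanishing Fourier transform too.
  have hre := ae_eq_zero_of_real_integral_exp_eq_zero hG.re fun a => by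
    have h2 : ∫ x, (Complex.exp (((∑ k, a k * x k : ℝ) : ℂ) * Complex.I) * G x +
        Complex.exp (((∑ k, a k * x k : ℝ) : ℂ) * Complex.I) * starRingEnd ℂ (G x)) = 0 := by
      rw [integral_add (hb a _ hG) (hb a _ hGc), h, hconj, add_zero]
    simp_rw [← mul_add, Complex.add_conj, Complex.ofReal_mul, mul_left_comm _ ((2 : ℝ) : ℂ),
      integral_const_mul] at h2
    simpa using h2
  have him := ae_eq_zero_of_real_integral_exp_eq_zero hG.im fun a => by
    have h2 : ∫ x, (Complex.exp (((∑ k, a k * x k : ℝ) : ℂ) * Complex.I) * G x -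
        Complex.exp (((∑ k, a k * x k : ℝ) : ℂ) * Complex.I) * starRingEnd ℂ (G x)) = 0 := by
      rw [integral_sub (hb a _ hG) (hb a _ hGc), h, hconj, sub_zero]
    simp_rw [← mul_sub, Complex.sub_conj, Complex.ofReal_mul, ← mul_assoc, integral_mul_const,
      mul_right_comm _ ((2 : ℝ) : ℂ), integral_mul_const] at h2
    simpa using h2
  filter_upwards [hre, him] with x h1 h2
  exact Complex.ext h1 h2

end Fourier

/-! ### A state is determined by its characteristic function -/

section Uniqueness

variable {m : ℕ}

theorem inner_modeSpace (f g : ModeSpace m) :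
    ⟪f, g⟫_ℂ = ∫ x, starRingEnd ℂ (f x) * g x := by
  rw [L2.inner_def]
  simp_rw [RCLike.inner_apply, mul_comm]

theorem ModeSpace.memLp_conj (f : ModeSpace m) :
    MemLp (fun x => starRingEnd ℂ (f x)) 2 (volume : Measure (Fin m → ℝ)) :=
  (Lp.memLp f).star

theorem ModeSpace.memLp_shift (f : ModeSpace m) (b : Fin m → ℝ) :
    MemLp (fun x => f (x + b)) 2 (volume : Measure (Fin m → ℝ)) :=
  (Lp.memLp f).comp_measurePreserving (measurePreserving_add_right volume b)

theorem ModeSpace.integral_norm_sq (f : ModeSpace m) : ∫ x, ‖f x‖ ^ 2 = ‖f‖ ^ 2 := by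
  have h := inner_self_eq_norm_sq_to_K (𝕜 := ℂ) f
  rw [inner_modeSpace] at h
  simp_rw [RCLike.conj_mul] at h
  have h2 : ((∫ x, ‖f x‖ ^ 2 : ℝ) : ℂ) = ((‖f‖ ^ 2 : ℝ) : ℂ) := by
    rw [← integral_complex_ofReal]
    simpa using h
  exact_mod_cast h2

theorem ModeSpace.integrable_norm_sq (f : ModeSpace m) : Integrable fun x => ‖f x‖ ^ 2 :=
  (memLp_two_iff_integrable_sq_norm (Lp.aestronglyMeasurable f)).1 (Lp.memLp f)

/-- The Cauchy–Schwarz inequality, in the form `‖f g‖₁ ≤ ‖f‖ ‖g‖`. -/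
theorem ModeSpace.integral_norm_conj_mul_le (f g : ModeSpace m) :
    ∫ x, ‖starRingEnd ℂ (f x) * g x‖ ≤ ‖f‖ * ‖g‖ := by
  have h := integral_mul_norm_le_Lp_mul_Lq (μ := volume) (f := f) (g := g)
    Real.HolderConjugate.two_two (by simpa using Lp.memLp f) (by simpa using Lp.memLp g)
  simp only [Real.rpow_two, ModeSpace.integral_norm_sq, ← Real.sqrt_eq_rpow,
    Real.sqrt_sq (norm_nonneg _)] at h
  simpa using h

theorem ModeSpace.integrable_conj_mul (f g : ModeSpace m) :
    Integrable fun x => starRingEnd ℂ (f x) * g x :=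
  (memLp_conj f).integrable_mul (Lp.memLp g)

/-- The `b`-th off-diagonal `x ↦ conj (f x) f (x + b)` of the integral kernel of `|f⟩⟨f|`. -/
noncomputable def kernelDiag (f : ModeSpace m) (b x : Fin m → ℝ) : ℂ :=
  starRingEnd ℂ (f x) * f (x + b)

theorem integrable_kernelDiag (f : ModeSpace m) (b : Fin m → ℝ) : Integrable (kernelDiag f b) :=
  f.memLp_conj.integrable_mul (f.memLp_shift b)

theorem integral_norm_kernelDiag_le (f : ModeSpace m) (b : Fin m → ℝ) :
    ∫ x, ‖kernelDiag f b x‖ ≤ ‖f‖ ^ 2 := by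
  have h := ModeSpace.integral_norm_conj_mul_le f
    (Lp.compMeasurePreservingₗᵢ ℂ (fun x : Fin m → ℝ => x + b)
      (measurePreserving_add_right volume b) f)
  rw [LinearIsometry.norm_map, ← sq] at h
  refine le_of_eq_of_le (integral_congr_ae ?_) h
  filter_upwards [Lp.coeFn_compMeasurePreserving f
    (measurePreserving_add_right (volume : Measure (Fin m → ℝ)) b)] with x hx
  rw [kernelDiag]
  congr 2
  exact hx.symm

theorem inner_weyl (f : ModeSpace m) (w : Quad m → ℝ) :
    ⟪f, weyl w f⟫_ℂ = ∫ x, weylPhase w x * kernelDiag f (fun k => w (k, 1)) x := by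
  rw [inner_modeSpace]
  refine integral_congr_ae ?_
  filter_upwards [weyl_apply_ae w f] with x hx
  rw [hx, kernelDiag]
  ring

theorem weylPhase_eq (w : Quad m → ℝ) (x : Fin m → ℝ) :
    weylPhase w x = Complex.exp ((((∑ k, w (k, 0) * w (k, 1)) / 2 : ℝ) : ℂ) * Complex.I) *
      Complex.exp (((∑ k, w (k, 0) * x k : ℝ) : ℂ) * Complex.I) := by
  rw [weylPhase, ← Complex.exp_add]
  push_cast
  ring_nf

theorem summable_integral_norm_kernelDiag {κ : Type*} {f : κ → ModeSpace m}
    (hf : Summable fun k => ‖f k‖ ^ 2) (b : Fin m → ℝ) :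
    Summable fun k => ∫ x, ‖kernelDiag (f k) b x‖ :=
  Summable.of_nonneg_of_le (fun _ => integral_nonneg fun _ => norm_nonneg _)
    (fun k => integral_norm_kernelDiag_le (f k) b) hf

/-- For fixed `b`, the values `∑ₖ ⟨fₖ, W(a, b) fₖ⟩` are up to a phase the Fourier transform in `a`
of the off-diagonal `∑ₖ kernelDiag fₖ b ∈ L¹`, hence determine it. -/
theorem tsum_integral_mul_kernelDiag_eq {κ κ' : Type*} [Countable κ] [Countable κ']
    {f : κ → ModeSpace m} {f' : κ' → ModeSpace m} (hf : Summable fun k => ‖f k‖ ^ 2)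
    (hf' : Summable fun k => ‖f' k‖ ^ 2)
    (h : ∀ w, ∑' k, ⟪f k, weyl w (f k)⟫_ℂ = ∑' k, ⟪f' k, weyl w (f' k)⟫_ℂ)
    (b : Fin m → ℝ) {φ : (Fin m → ℝ) → ℂ} (hφ : AEStronglyMeasurable φ volume)
    (hφb : ∃ C, ∀ᵐ x, ‖φ x‖ ≤ C) :
    ∑' k, ∫ x, φ x * kernelDiag (f k) b x = ∑' k, ∫ x, φ x * kernelDiag (f' k) b x := by
  obtain ⟨G, hG, hGs⟩ := exists_integrable_hasSum_integral_mul
    (fun k => integrable_kernelDiag (f k) b) (summable_integral_norm_kernelDiag hf b)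
  obtain ⟨G', hG', hGs'⟩ := exists_integrable_hasSum_integral_mul
    (fun k => integrable_kernelDiag (f' k) b) (summable_integral_norm_kernelDiag hf' b)
  have hGG : G =ᵐ[volume] G' := by
    have h0 := ae_eq_zero_of_integral_exp_eq_zero (hG.sub hG') fun a => by
      set w : Quad m → ℝ := fun p => ![a p.1, b p.1] p.2
      have hm : AEStronglyMeasurable (weylPhase w) (volume : Measure (Fin m → ℝ)) :=
        (continuous_weylPhase w).aestronglyMeasurable
      have hbd : ∃ C, ∀ᵐ x : Fin m → ℝ, ‖weylPhase w x‖ ≤ C :=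
        ⟨1, Filter.Eventually.of_forall fun x => (norm_weylPhase w x).le⟩
      have hw := h w
      simp_rw [inner_weyl] at hw
      have h1 : ∫ x, weylPhase w x * G x = ∫ x, weylPhase w x * G' x := by
        rw [← (hGs _ hm hbd).tsum_eq, ← (hGs' _ hm hbd).tsum_eq]
        exact hw
      rw [← sub_eq_zero, ← integral_sub (hG.bdd_mul hm hbd.choose_spec)
        (hG'.bdd_mul hm hbd.choose_spec)] at h1
      simp_rw [← mul_sub, weylPhase_eq, mul_assoc, integral_const_mul] at h1
      exact (mul_eq_zero.1 h1).resolve_left (Complex.exp_ne_zero _)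
    filter_upwards [h0] with x hx
    exact sub_eq_zero.1 hx
  rw [(hGs φ hφ hφb).tsum_eq, (hGs' φ hφ hφb).tsum_eq]
  refine integral_congr_ae ?_
  filter_upwards [hGG] with x hx
  rw [hx]

theorem integrable_prod_mul_shift {P Q : (Fin m → ℝ) → ℂ} (hP : Integrable P)
    (hQ : Integrable Q) :
    Integrable (fun z : (Fin m → ℝ) × (Fin m → ℝ) => P z.1 * Q (z.1 + z.2))
      (volume.prod volume) :=
  (measurePreserving_prod_add volume volume).integrable_comp_of_integrable (hP.mul_prod hQ)

/-- With `P = conj f · h` and `Q = conj g · f`, integration over all off-diagonals `b` recovers the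
matrix element `⟨f, h⟩⟨g, f⟩` of `|f⟩⟨f|`. -/
theorem integral_integral_mul_shift {𝕜 : Type*} [RCLike 𝕜] (P Q : (Fin m → ℝ) → 𝕜)
    (hi : Integrable (fun z : (Fin m → ℝ) × (Fin m → ℝ) => P z.1 * Q (z.1 + z.2))
      (volume.prod volume)) :
    ∫ b, ∫ x, P x * Q (x + b) = (∫ x, P x) * ∫ y, Q y := by
  rw [integral_integral_swap (f := fun b x => P x * Q (x + b)) hi.swap]
  simp_rw [integral_const_mul, integral_add_left_eq_self]
  rw [integral_mul_const]

/-- A matrix element as an integral over all off-diagonals of the integral kernel. -/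
theorem IsEnsemble.inner_eq_integral {κ : Type*} [Countable κ] {T : ModeSpace m →L[ℂ] ModeSpace m}
    {f : κ → ModeSpace m} (hf : IsEnsemble T f) (g h : ModeSpace m) :
    ⟪g, T h⟫_ℂ =
      ∫ b, ∑' k, ∫ x, (starRingEnd ℂ (g (x + b)) * h x) * kernelDiag (f k) b x := by
  set P : κ → (Fin m → ℝ) → ℂ := fun k x => starRingEnd ℂ (f k x) * h x
  set Q : κ → (Fin m → ℝ) → ℂ := fun k x => starRingEnd ℂ (g x) * f k x
  have hi : ∀ k, Integrable (fun z : (Fin m → ℝ) × (Fin m → ℝ) => P k z.1 * Q k (z.1 + z.2))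
      (volume.prod volume) := fun k =>
    integrable_prod_mul_shift ((f k).integrable_conj_mul h) (g.integrable_conj_mul (f k))
  have hPQ : ∀ k b, ∫ x, (starRingEnd ℂ (g (x + b)) * h x) * kernelDiag (f k) b x =
      ∫ x, P k x * Q k (x + b) := fun k b => by
    refine integral_congr_ae (Filter.Eventually.of_forall fun x => ?_)
    simp only [P, Q, kernelDiag]
    ring
  have hsum : Summable fun k => ∫ b, ‖∫ x, P k x * Q k (x + b)‖ := by
    refine Summable.of_nonneg_of_le (fun k => integral_nonneg fun b => norm_nonneg _)
      (fun k => ?_) (hf.summable_sq.mul_left (‖g‖ * ‖h‖))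
    calc ∫ b, ‖∫ x, P k x * Q k (x + b)‖
        ≤ ∫ b, ∫ x, ‖P k x‖ * ‖Q k (x + b)‖ := by
          refine integral_mono (hi k).integral_prod_right.norm ?_ fun b => ?_
          · simpa only [norm_mul] using (hi k).norm.integral_prod_right
          · simpa only [norm_mul] using
              norm_integral_le_integral_norm fun x => P k x * Q k (x + b)
      _ = (∫ x, ‖P k x‖) * ∫ y, ‖Q k y‖ :=
          integral_integral_mul_shift (fun x => ‖P k x‖) (fun x => ‖Q k x‖)
            (by simpa only [norm_mul] using (hi k).norm)
      _ ≤ (‖f k‖ * ‖h‖) * (‖g‖ * ‖f k‖) := by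
          gcongr
          · exact (f k).integral_norm_conj_mul_le h
          · exact g.integral_norm_conj_mul_le (f k)
      _ = ‖g‖ * ‖h‖ * ‖f k‖ ^ 2 := by ring
  have h1 := hasSum_integral_of_summable_integral_norm
    (fun k => (hi k).integral_prod_right) hsum
  simp_rw [hPQ]
  refine ((hf.hasSum_inner g h).congr_fun fun k => ?_).unique h1
  rw [integral_integral_mul_shift _ _ (hi k), inner_modeSpace, inner_modeSpace, mul_comm]

theorem exists_bound_simpleFunc (g : Lp.simpleFunc ℂ 2 (volume : Measure (Fin m → ℝ))) :
    ∃ C, ∀ᵐ x, ‖(g : ModeSpace m) x‖ ≤ C := by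
  obtain ⟨C, hC⟩ := (Lp.simpleFunc.toSimpleFunc g).exists_forall_norm_le
  refine ⟨C, ?_⟩
  filter_upwards [Lp.simpleFunc.toSimpleFunc_eq_toFun g] with x hx
  rw [← hx]
  exact hC x

/-- An operator with an ensemble `f` is determined by the characteristic function
`w ↦ ∑ₖ ⟨fₖ, W(w) fₖ⟩`. The matrix elements are compared between simple functions `g`, `h`, which
are dense, and for which the weight `conj (g (x + b)) h x` is bounded. -/
theorem IsEnsemble.eq_of_tsum_inner_weyl_eq {κ κ' : Type*} [Countable κ] [Countable κ']
    {T T' : ModeSpace m →L[ℂ] ModeSpace m} {f : κ → ModeSpace m} {f' : κ' → ModeSpace m}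
    (hf : IsEnsemble T f) (hf' : IsEnsemble T' f')
    (h : ∀ w, ∑' k, ⟪f k, weyl w (f k)⟫_ℂ = ∑' k, ⟪f' k, weyl w (f' k)⟫_ℂ) : T = T' := by
  have hd : DenseRange ((↑) : Lp.simpleFunc ℂ 2 (volume : Measure (Fin m → ℝ)) → ModeSpace m) :=
    Lp.simpleFunc.denseRange (by norm_num)
  have key : ∀ g g' : Lp.simpleFunc ℂ 2 (volume : Measure (Fin m → ℝ)),
      ⟪(g : ModeSpace m), T g'⟫_ℂ = ⟪(g : ModeSpace m), T' g'⟫_ℂ := fun g g' => by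
    rw [hf.inner_eq_integral, hf'.inner_eq_integral]
    congr 1
    ext b
    obtain ⟨C, hC⟩ := exists_bound_simpleFunc g
    obtain ⟨C', hC'⟩ := exists_bound_simpleFunc g'
    refine tsum_integral_mul_kernelDiag_eq hf.summable_sq hf'.summable_sq h b
      ((ModeSpace.memLp_shift (g : ModeSpace m) b).star.aestronglyMeasurable.mul
        (Lp.aestronglyMeasurable _)) ⟨C * C', ?_⟩
    filter_upwards [(measurePreserving_add_right volume b).quasiMeasurePreserving.ae hC, hC']
      with x hx hx'
    rw [norm_mul, RCLike.norm_conj]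
    gcongr
    exact (norm_nonneg _).trans hx
  refine ContinuousLinearMap.ext fun x => ?_
  refine congrFun (hd.equalizer T.continuous T'.continuous (funext fun g' => ?_)) x
  exact hd.eq_of_inner_right ℂ fun g => key g g'

end Uniqueness

/-! ### Permutations of the modes -/

section Permutation

variable {m : ℕ}

theorem measurePreserving_comp_perm (π : Equiv.Perm (Fin m)) :
    MeasurePreserving (fun x : Fin m → ℝ => x ∘ π) volume volume :=
  (volume_measurePreserving_piCongrLeft (fun _ => ℝ) π).symm

/-- The unitary `(U f)(x) = f (x ∘ π)` on `L²(ℝᵐ)` that permutes the modes. -/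
noncomputable def permUnitary (π : Equiv.Perm (Fin m)) : ModeSpace m ≃ₗᵢ[ℂ] ModeSpace m :=
  LinearIsometryEquiv.ofSurjective
    (Lp.compMeasurePreservingₗᵢ ℂ (fun x : Fin m → ℝ => x ∘ π) (measurePreserving_comp_perm π))
    fun f => by
      refine ⟨Lp.compMeasurePreservingₗᵢ ℂ (fun x : Fin m → ℝ => x ∘ π.symm)
        (measurePreserving_comp_perm π.symm) f, Lp.ext ?_⟩
      filter_upwards [Lp.coeFn_compMeasurePreserving (Lp.compMeasurePreservingₗᵢ ℂ
          (fun x : Fin m → ℝ => x ∘ π.symm) (measurePreserving_comp_perm π.symm) f)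
          (measurePreserving_comp_perm π),
        (measurePreserving_comp_perm π).quasiMeasurePreserving.ae
          (Lp.coeFn_compMeasurePreserving f (measurePreserving_comp_perm π.symm))] with x h1 h2
      refine h1.trans (h2.trans ?_)
      simp [Function.comp_assoc]

theorem permUnitary_apply_ae (π : Equiv.Perm (Fin m)) (f : ModeSpace m) :
    ∀ᵐ x : Fin m → ℝ, permUnitary π f x = f (x ∘ π) :=
  Lp.coeFn_compMeasurePreserving f (measurePreserving_comp_perm π)

/-- The vector of quadrature coefficients with the modes relabelled by `π`. -/
def permQuad (π : Equiv.Perm (Fin m)) (w : Quad m → ℝ) : Quad m → ℝ := fun p => w (π p.1, p.2)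

theorem weylPhase_permQuad (π : Equiv.Perm (Fin m)) (w : Quad m → ℝ) (x : Fin m → ℝ) :
    weylPhase (permQuad π w) (x ∘ π) = weylPhase w x := by
  simp only [weylPhase, permQuad, Function.comp_apply]
  rw [Equiv.sum_comp π fun k => w (k, 0) * x k, Equiv.sum_comp π fun k => w (k, 0) * w (k, 1)]

theorem weyl_permUnitary (π : Equiv.Perm (Fin m)) (w : Quad m → ℝ) (f : ModeSpace m) :
    weyl w (permUnitary π f) = permUnitary π (weyl (permQuad π w) f) := by
  refine Lp.ext ?_
  filter_upwards [weyl_apply_ae w (permUnitary π f), permUnitary_apply_ae π (weyl (permQuad π w) f),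
    (measurePreserving_comp_perm π).quasiMeasurePreserving.ae (weyl_apply_ae (permQuad π w) f),
    (measurePreserving_add_right (volume : Measure (Fin m → ℝ))
      fun k => w (k, 1)).quasiMeasurePreserving.ae (permUnitary_apply_ae π f)] with x h1 h2 h3 h4
  rw [h1, h2, h3, h4, weylPhase_permQuad]
  rfl

/-- Relabelling the argument of the characteristic function conjugates the state by the unitary
that permutes the modes; in particular (`π = 1`) the characteristic function determines the
state. -/
theorem op_eq_unitaryConj_of_charFn_eq (π : Equiv.Perm (Fin m)) {ρ ρ' : DensityOperator m}
    (h : ∀ w, charFn ρ' w = charFn ρ (permQuad π w)) :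
    ρ'.op = unitaryConj (permUnitary π) ρ.op := by
  obtain ⟨s, f, hs, hf⟩ := ρ.exists_isEnsemble
  obtain ⟨s', f', hs', hf'⟩ := ρ'.exists_isEnsemble
  refine hf'.eq_of_tsum_inner_weyl_eq (hf.map (permUnitary π)) fun w => ?_
  rw [← hf'.opTrace_comp (weyl w)]
  refine (h w).trans ((hf.opTrace_comp _).trans (tsum_congr fun k => ?_))
  rw [weyl_permUnitary, LinearIsometryEquiv.inner_map_map]

end Permutation

/-! ### Pairs of patterns up to permutation -/

section Patterns

/-- Two functions on a finite type with fibres of equal size differ by a permutation. -/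
theorem exists_perm_comp_eq {α β : Type*} [Fintype α] [DecidableEq β] (p q : α → β)
    (h : ∀ b, (Finset.univ.filter fun a => p a = b).card =
      (Finset.univ.filter fun a => q a = b).card) :
    ∃ π : Equiv.Perm α, ∀ a, q (π a) = p a := by
  have e : ∀ b, Nonempty ({a // p a = b} ≃ {a // q a = b}) := fun b =>
    Fintype.card_eq.1 (by simpa only [Fintype.card_subtype] using h b)
  refine ⟨Equiv.ofFiberEquiv fun b => (e b).some, fun a => ?_⟩
  exact Equiv.ofFiberEquiv_map _ a

/-- The numbers of targets in two patterns and their Hamming distance determine how many modes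
carry each of the four pairs of channels. -/
theorem exists_perm_of_hammingDist_eq {m u v : ℕ} {i i' j j' : Pattern m}
    (hi : i ∈ cpfSpace m u) (hi' : i' ∈ cpfSpace m v) (hj : j ∈ cpfSpace m u)
    (hj' : j' ∈ cpfSpace m v) (hd : hammingDist i i' = hammingDist j j') :
    ∃ π : Equiv.Perm (Fin m), ∀ k, j (π k) = i k ∧ j' (π k) = i' k := by
  have hu : ∀ p q : Pattern m, (Finset.univ.filter fun k => p k = true).card =
      (Finset.univ.filter fun k => (p k, q k) = (true, true)).card +
      (Finset.univ.filter fun k => (p k, q k) = (true, false)).card := fun p q => by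
    simp only [Finset.card_filter, ← Finset.sum_add_distrib]
    refine Finset.sum_congr rfl fun k _ => ?_
    cases p k <;> cases q k <;> rfl
  have hv : ∀ p q : Pattern m, (Finset.univ.filter fun k => q k = true).card =
      (Finset.univ.filter fun k => (p k, q k) = (true, true)).card +
      (Finset.univ.filter fun k => (p k, q k) = (false, true)).card := fun p q => by
    simp only [Finset.card_filter, ← Finset.sum_add_distrib]
    refine Finset.sum_congr rfl fun k _ => ?_
    cases p k <;> cases q k <;> rfl
  have hh : ∀ p q : Pattern m, hammingDist p q =
      (Finset.univ.filter fun k => (p k, q k) = (true, false)).card +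
      (Finset.univ.filter fun k => (p k, q k) = (false, true)).card := fun p q => by
    simp only [hammingDist, Finset.card_filter, ← Finset.sum_add_distrib]
    refine Finset.sum_congr rfl fun k _ => ?_
    cases p k <;> cases q k <;> rfl
  have hm : ∀ p q : Pattern m, m =
      (Finset.univ.filter fun k => (p k, q k) = (true, true)).card +
      (Finset.univ.filter fun k => (p k, q k) = (true, false)).card +
      (Finset.univ.filter fun k => (p k, q k) = (false, true)).card +
      (Finset.univ.filter fun k => (p k, q k) = (false, false)).card := fun p q => by
    conv_lhs => rw [← Fintype.card_fin m, ← Finset.card_univ, Finset.card_eq_sum_ones]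
    simp only [Finset.card_filter, ← Finset.sum_add_distrib]
    refine Finset.sum_congr rfl fun k _ => ?_
    cases p k <;> cases q k <;> rfl
  simp only [cpfSpace, Set.mem_ofPred_eq] at hi hi' hj hj'
  obtain ⟨π, hπ⟩ := exists_perm_comp_eq (fun k => (i k, i' k)) (fun k => (j k, j' k)) (by
    have := hu i i'; have := hv i i'; have := hh i i'; have := hm i i'
    have := hu j j'; have := hv j j'; have := hh j j'; have := hm j j'
    rintro ⟨_ | _, _ | _⟩ <;> omega)
  exact ⟨π, fun k => by simpa using hπ k⟩

end Patterns

/-! ### Output states -/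

section Output

variable {m : ℕ}

theorem dotProduct_patternMatrix_mulVec_permQuad (a : Bool → ℝ) {i j : Pattern m}
    {π : Equiv.Perm (Fin m)} (h : ∀ k, j (π k) = i k) (w : Quad m → ℝ) :
    permQuad π w ⬝ᵥ (patternMatrix a i).mulVec (permQuad π w) =
      w ⬝ᵥ (patternMatrix a j).mulVec w := by
  simp only [patternMatrix, dotProduct, Matrix.mulVec_diagonal, permQuad, ← h]
  exact Equiv.sum_comp (π.prodCongr (Equiv.refl (Fin 2))) fun p => w p * (a (j p.1) * w p)

theorem patternMatrix_transpose_mulVec_permQuad (a : Bool → ℝ) {i j : Pattern m}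
    {π : Equiv.Perm (Fin m)} (h : ∀ k, j (π k) = i k) (w : Quad m → ℝ) :
    (patternMatrix a i).transpose.mulVec (permQuad π w) =
      permQuad π ((patternMatrix a j).transpose.mulVec w) := by
  ext p
  simp [patternMatrix, Matrix.mulVec_diagonal, permQuad, h]

/-- The CV-GHZ covariance matrix is invariant under permutations of the modes. -/
theorem dotProduct_ghzCov_mulVec_permQuad (μ c₁ c₂ : ℝ) (π : Equiv.Perm (Fin m))
    (w : Quad m → ℝ) :
    permQuad π w ⬝ᵥ (ghzCov m μ c₁ c₂).mulVec (permQuad π w) =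
      w ⬝ᵥ (ghzCov m μ c₁ c₂).mulVec w := by
  set e := π.prodCongr (Equiv.refl (Fin 2))
  refine Eq.trans (Finset.sum_congr rfl fun p _ => ?_)
    (Equiv.sum_comp e fun p => w p * (ghzCov m μ c₁ c₂).mulVec w p)
  refine congrArg (w (e p) * ·) (Eq.trans (Finset.sum_congr rfl fun q _ => ?_)
    (Equiv.sum_comp e fun q => ghzCov m μ c₁ c₂ (e p) q * w q))
  simp only [ghzCov, permQuad, e, Matrix.of_apply, Equiv.prodCongr_apply, Prod.map_fst,
    Prod.map_snd, Equiv.coe_refl, id_eq, EmbeddingLike.apply_eq_iff_eq]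
  rfl

/-- The output states of two patterns that differ by `π` are related by the unitary that permutes
the modes, even for two input states, as both have the same characteristic function. -/
theorem output_op_eq_unitaryConj {μ c₁ c₂ : ℝ} {τ ν : Bool → ℝ} {Φ Ψ : DensityOperator m}
    (hΦ : IsCVGHZ μ c₁ c₂ Φ) (hΨ : IsCVGHZ μ c₁ c₂ Ψ) {i j : Pattern m}
    {E E' : DensityOperator m → DensityOperator m} (hE : IsGPIPattern τ ν i E)
    (hE' : IsGPIPattern τ ν j E') {π : Equiv.Perm (Fin m)} (h : ∀ k, j (π k) = i k) :
    (E' Ψ).op = unitaryConj (permUnitary π) (E Φ).op := by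
  refine op_eq_unitaryConj_of_charFn_eq π fun w => ?_
  rw [hE.charFn_apply, hE'.charFn_apply, hΦ, hΨ, patternMatrix_transpose_mulVec_permQuad _ h,
    dotProduct_ghzCov_mulVec_permQuad, dotProduct_patternMatrix_mulVec_permQuad _ h]

end Output

theorem theorem1 (m : ℕ) (μ c₁ c₂ : ℝ) (τ ν : Bool → ℝ) :
    ∃ F : ℕ → ℕ → ℕ → ℝ,
      ∀ Φ : DensityOperator m, IsCVGHZ μ c₁ c₂ Φ →
        ∀ u v d : ℕ, ∀ i ∈ cpfSpace m u, ∀ i' ∈ cpfSpace m v, hammingDist i i' = d →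
          ∀ E E' : DensityOperator m → DensityOperator m,
            IsGPIPattern τ ν i E → IsGPIPattern τ ν i' E' →
              fidelity (E Φ) (E' Φ) = F u v d := by
  classical
  suffices h : ∀ u v d : ℕ, ∃ x : ℝ, ∀ Φ : DensityOperator m, IsCVGHZ μ c₁ c₂ Φ →
      ∀ i ∈ cpfSpace m u, ∀ i' ∈ cpfSpace m v, hammingDist i i' = d →
        ∀ E E' : DensityOperator m → DensityOperator m,
          IsGPIPattern τ ν i E → IsGPIPattern τ ν i' E' → fidelity (E Φ) (E' Φ) = x by
    choose F hF using h
    exact ⟨F, fun Φ hΦ u v d => hF u v d Φ hΦ⟩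
  intro u v d
  by_cases hex : ∃ Φ : DensityOperator m, IsCVGHZ μ c₁ c₂ Φ ∧
      ∃ i ∈ cpfSpace m u, ∃ i' ∈ cpfSpace m v, hammingDist i i' = d ∧
        ∃ E E' : DensityOperator m → DensityOperator m,
          IsGPIPattern τ ν i E ∧ IsGPIPattern τ ν i' E'
  · obtain ⟨Φ, hΦ, i, hi, i', hi', hd, E, E', hE, hE'⟩ := hex
    refine ⟨fidelity (E Φ) (E' Φ), fun Ψ hΨ j hj j' hj' hd' D D' hD hD' => ?_⟩
    obtain ⟨π, hπ⟩ := exists_perm_of_hammingDist_eq hi hi' hj hj' (hd.trans hd'.symm)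
    exact fidelity_eq_of_unitaryConj (permUnitary π)
      (output_op_eq_unitaryConj hΦ hΨ hE hD fun k => (hπ k).1)
      (output_op_eq_unitaryConj hΦ hΨ hE' hD' fun k => (hπ k).2)
  -- If no pair of output states has these parameters, any value will do.
  · exact ⟨0, fun Φ hΦ i hi i' hi' hd E E' hE hE' =>
      (hex ⟨Φ, hΦ, i, hi, i', hi', hd, E, E', hE, hE'⟩).elim⟩
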